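/- Let $A$ be a totally ordered set (the alphabet). The \emph{plactic monoid} $\mathbf{Pl}_A$ is the quotient of the free monoid $A^*$ by the congruence generated by the Knuth relations $xzy \sim zxy$ for $x \le y < z$ and $yxz \sim yzx$ for $x < y \le z$ ($x,y,z\in A$). Let $\mathbf{Row}_A$ be the set of non-decreasing words in $A^*$ and $\mathbf{Col}_A$ the set of strictly decreasing words in $A^*$; the empty word is included in both, and is denoted by $e_R$ and $e_C$ respectively. A row is identified with a Young tableau on $A$ with at most one row, and a column (read from top to bottom) with a Young tableau with at most one column; tableaux are drawn in the French convention, with the longest row at the bottom. For Young tableaux $T, T'$ let $T \ast T'$ be the tableau obtained from $T$ by inserting, by Schensted's right insertion algorithm, the letters of the row reading of $T'$ (its rows from top to bottom, each from left to right) one after the other. For $r_1, r_2 \in \mathbf{Row}_A$ the tableau $r_1 \ast r_2$ has at most two rows, and $\sigma_R(r_1,r_2)$ is the pair (upper row, lower row) of $r_1\ast r_2$, where the upper row is $e_R$ if there is only one row, and both are $e_R$ if the tableau is empty. For $c_1,c_2 \in \mathbf{Col}_A$ the tableau $c_1 \ast c_2$ has at most two columns, and $\sigma_C(c_1,c_2)$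 is the pair (left column, right column) of $c_1 \ast c_2$, where the right column is $e_C$ if there is only one column, and both are $e_C$ if the tableau is empty. A \emph{pseudo-unital idempotent braided set} $(X,\sigma,e)$ is a set $X$ with a map $\sigma \colon X\times X \to X \times X$ and an element $e \in X$ (the pseudo-unit) such that $\sigma$ satisfies the Yang--Baxter equation $(\sigma \times \mathrm{Id})(\mathrm{Id}\times\sigma)(\sigma\times \mathrm{Id}) = (\mathrm{Id}\times\sigma)(\sigma\times \mathrm{Id})(\mathrm{Id}\times\sigma)$ on $X^3$; $\sigma\sigma=\sigma$; for all $x\in X$ both $\sigma(e,x)$ and $\sigma(x,e)$ lie in $\{(e,x),(x,e)\}$; and dropping any occurrence of $e$ from a normal word leaves a normal word, where $x_1\cdots x_k \in X^*$ is normal if $\sigma(x_j,x_{j+1})=(x_j,x_{j+1})$ for all $1\le j<k$. Its \emph{reduced structure monoid} is the monoid generated by $X$ with the relations $xy=y'x'$ whenever $\sigma(x,y)=(y',x')$, and $e = 1$. \textbf{Theorem.} $(\mathbf{Row}_A,\sigma_R,e_R)$ and $(\mathbf{Col}_A,\sigma_C,e_C)$ are pseudo-unital idempotent braided sets, and the reduced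 structure monoid of each of them is isomorphic, as a monoid, to the plactic monoid $\mathbf{Pl}_A$, by an isomorphism that sends the generator given by a row (respectively, a column) to the class in $\mathbf{Pl}_A$ of this row (respectively, column), seen as a word in $A^*$. -/

import Mathlib

namespace PlacticBraid

section Braidings

variable {X : Type*}

/-- The map `σ × Id` on `X × X × X`. -/
def onLeft (σ : X × X → X × X) (t : X × X × X) : X × X × X :=
  ((σ (t.1, t.2.1)).1, (σ (t.1, t.2.1)).2, t.2.2)

/-- The map `Id × σ` on `X × X × X`. -/
def onRight (σ : X × X → X × X) (t : X × X × X) : X × X × X :=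
  (t.1, σ t.2)

/-- A braiding on the set `X`: a set-theoretic solution of the Yang-Baxter equation. -/
def IsBraiding (σ : X × X → X × X) : Prop :=
  ∀ t : X × X × X,
    onLeft σ (onRight σ (onLeft σ t)) = onRight σ (onLeft σ (onRight σ t))

/-- A word `x₁ … x_k` in the letters of `X` is normal if `σ` fixes every pair of
neighbouring letters. -/
def IsNormal (σ : X × X → X × X) (w : List X) : Prop :=
  w.IsChain fun x y => σ (x, y) = (x, y)

/-- `(X, σ, e)` is a pseudo-unital idempotent braided set. -/
structure IsPUIBS (σ : X × X → X × X) (e : X) : Prop where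
  /-- `σ` is a braiding. -/
  braiding : IsBraiding σ
  /-- `σ` is idempotent. -/
  idem : ∀ p, σ (σ p) = σ p
  /-- `σ (e, x)` is one of `(e, x)` and `(x, e)`. -/
  left_unit : ∀ x, σ (e, x) = (e, x) ∨ σ (e, x) = (x, e)
  /-- `σ (x, e)` is one of `(e, x)` and `(x, e)`. -/
  right_unit : ∀ x, σ (x, e) = (e, x) ∨ σ (x, e) = (x, e)
  /-- Dropping any occurrence of `e` from a normal word leaves a normal word. -/
  drop_unit : ∀ u v : List X, IsNormal σ (u ++ e :: v) → IsNormal σ (u ++ v)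

/-- The defining relations of the reduced structure monoid of `(X, σ, e)`: `x y = y' x'` whenever
`σ (x, y) = (y', x')`, and the letter `e` is identified with the empty word. -/
inductive ReducedRel (σ : X × X → X × X) (e : X) : FreeMonoid X → FreeMonoid X → Prop
  | braid (x y y' x' : X) (h : σ (x, y) = (y', x')) :
      ReducedRel σ e (FreeMonoid.of x * FreeMonoid.of y) (FreeMonoid.of y' * FreeMonoid.of x')
  | unit : ReducedRel σ e (FreeMonoid.of e) 1

/-- The reduced structure monoid of `(X, σ, e)`. -/
abbrev ReducedStructureMonoid (σ : X × X → X × X) (e : X) : Type _ :=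
  PresentedMonoid (ReducedRel σ e)

end Braidings

section Plactic

/-- The Knuth relations. -/
inductive KnuthRel (A : Type*) [LinearOrder A] : FreeMonoid A → FreeMonoid A → Prop
  | xzy (x y z : A) (hxy : x ≤ y) (hyz : y < z) :
      KnuthRel A (FreeMonoid.ofList [x, z, y]) (FreeMonoid.ofList [z, x, y])
  | yxz (x y z : A) (hxy : x < y) (hyz : y ≤ z) :
      KnuthRel A (FreeMonoid.ofList [y, x, z]) (FreeMonoid.ofList [y, z, x])

/-- The plactic monoid on the totally ordered alphabet `A`. -/
abbrev Plactic (A : Type*) [LinearOrder A] : Type _ := PresentedMonoid (KnuthRel A)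

/-- The class in the plactic monoid of a word in the alphabet `A`. -/
def Plactic.ofWord {A : Type*} [LinearOrder A] (w : List A) : Plactic A :=
  PresentedMonoid.mk (KnuthRel A) (FreeMonoid.ofList w)

end Plactic

section Tableaux

/-- Rows on `A`, including the empty one: non-decreasing words. -/
@[ext]
structure Row (A : Type*) [LinearOrder A] where
  /-- The underlying word. -/
  word : List A
  /-- The word is non-decreasing. -/
  mono : word.Pairwise (· ≤ ·)

/-- Columns on `A`, including the empty one: (strictly) decreasing words. -/
@[ext]
structure Col (A : Type*) [LinearOrder A] where
  /-- The underlying word. -/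
  word : List A
  /-- The word is strictly decreasing. -/
  anti : word.Pairwise (· > ·)

variable {A : Type*} [LinearOrder A]

/-- The empty row. -/
def Row.empty : Row A := ⟨[], List.Pairwise.nil⟩

/-- The empty column. -/
def Col.empty : Col A := ⟨[], List.Pairwise.nil⟩

/-- The relation `x₁ … x_s ≻ y₁ … y_t` on words: `s ≤ t` and `x_i > y_i` for all `i ≤ s`. -/
def RowGT (x y : List A) : Prop :=
  x.length ≤ y.length ∧ ∀ (i : ℕ) (hx : i < x.length) (hy : i < y.length), x[i] > y[i]

/-- `L`, the list of the rows from the bottom row up, is the list of rows of a Young tableau. -/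
structure IsTableau (L : List (List A)) : Prop where
  /-- Every row is non-empty. -/
  ne_nil : ∀ r ∈ L, r ≠ []
  /-- Every row is non-decreasing. -/
  mono : ∀ r ∈ L, r.Pairwise (· ≤ ·)
  /-- The rows decrease for `≻` from top to bottom. -/
  chain : L.IsChain fun lower upper => RowGT upper lower

/-- Young tableaux on `A`, in the French convention (the longest row is at the bottom): finite
sequences of non-empty rows which decrease for `≻` from top to bottom. The rows are listed
from bottom to top. -/
@[ext]
structure YoungTableau (A : Type*) [LinearOrder A] where
  /-- The rows, from the bottom row up. -/
  rows : List (List A)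
  /-- They form a tableau. -/
  isTableau : IsTableau rows

/-- Insertion of `x` into a single row: if no letter exceeds `x`, then `x` is attached to the right;
otherwise `x` replaces the leftmost letter exceeding it, and that letter is returned. -/
def rowInsert (x : A) : List A → List A × Option A
  | [] => ([x], none)
  | y :: r => if x < y then (x :: r, some y) else (y :: (rowInsert x r).1, (rowInsert x r).2)

/-- Right Schensted insertion on lists of rows, bottom row first. -/
def insertRows (x : A) : List (List A) → List (List A)
  | [] => [[x]]
  | r :: L =>
    match rowInsert x r with
    | (r', none) => r' :: L
    | (r', some y) => r' :: insertRows y L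

/-! Right Schensted insertion yields a Young tableau. -/

theorem rowGT_nil (r : List A) : RowGT [] r := by
  simp [RowGT]

theorem rowGT_cons {a b : A} {s r : List A} :
    RowGT (a :: s) (b :: r) ↔ b < a ∧ RowGT s r := by
  constructor
  · rintro ⟨h1, h2⟩
    refine ⟨h2 0 (Nat.succ_pos _) (Nat.succ_pos _), Nat.le_of_succ_le_succ h1, fun i hx hy => ?_⟩
    exact h2 (i + 1) (Nat.succ_lt_succ hx) (Nat.succ_lt_succ hy)
  · rintro ⟨h0, h1, h2⟩
    refine ⟨by simpa using h1, fun i hx hy => ?_⟩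
    cases i with
    | zero => simpa using h0
    | succ i => simpa using h2 i (by simpa using hx) (by simpa using hy)

theorem not_rowGT_cons_nil (a : A) (s : List A) : ¬ RowGT (a :: s) [] := by
  simp [RowGT]

theorem rowInsert_ne_nil (x : A) (r : List A) : (rowInsert x r).1 ≠ [] := by
  cases r with
  | nil => simp [rowInsert]
  | cons y r =>
    rw [rowInsert]
    split_ifs <;> simp

theorem lt_of_bump {x y : A} {r : List A} (h : (rowInsert x r).2 = some y) : x < y := by
  induction r with
  | nil => simp [rowInsert] at h
  | cons b r ih =>
    rw [rowInsert] at h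
    split_ifs at h with hx
    · simp only [Option.some.injEq] at h
      exact h ▸ hx
    · exact ih h

theorem mem_rowInsert {x z : A} {r : List A} (h : z ∈ (rowInsert x r).1) : z = x ∨ z ∈ r := by
  induction r with
  | nil => simpa [rowInsert] using h
  | cons b r ih =>
    rw [rowInsert] at h
    split_ifs at h with hx
    · simp only [List.mem_cons] at h ⊢
      tauto
    · simp only [List.mem_cons] at h ⊢
      rcases h with h | h
      · tauto
      · have := ih h
        tauto

theorem rowInsert_mono {x : A} {r : List A} (h : r.Pairwise (· ≤ ·)) :
    (rowInsert x r).1.Pairwise (· ≤ ·) := by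
  induction r with
  | nil => simp [rowInsert]
  | cons b r ih =>
    rw [List.pairwise_cons] at h
    rw [rowInsert]
    split_ifs with hx
    · exact List.pairwise_cons.2 ⟨fun z hz => hx.le.trans (h.1 z hz), h.2⟩
    · refine List.pairwise_cons.2 ⟨fun z hz => ?_, ih h.2⟩
      rcases mem_rowInsert hz with rfl | hz
      · exact not_lt.1 hx
      · exact h.1 z hz

theorem rowGT_rowInsert_lower {x : A} {s r : List A} (h : RowGT s r) :
    RowGT s (rowInsert x r).1 := by
  induction s generalizing r with
  | nil => exact rowGT_nil _
  | cons a s ih =>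
    cases r with
    | nil => exact absurd h (not_rowGT_cons_nil a s)
    | cons b r =>
      rw [rowGT_cons] at h
      rw [rowInsert]
      split_ifs with hx
      · exact rowGT_cons.2 ⟨hx.trans h.1, h.2⟩
      · exact rowGT_cons.2 ⟨h.1, ih h.2⟩

theorem rowGT_rowInsert {x y : A} {s r : List A} (h : RowGT s r)
    (hy : (rowInsert x r).2 = some y) : RowGT (rowInsert y s).1 (rowInsert x r).1 := by
  induction r generalizing s with
  | nil => simp [rowInsert] at hy
  | cons b r ih =>
    have hxy := lt_of_bump hy
    rw [rowInsert] at hy ⊢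
    split_ifs at hy ⊢ with hx
    · simp only [Option.some.injEq] at hy
      subst hy
      cases s with
      | nil => exact rowGT_cons.2 ⟨hx, rowGT_nil _⟩
      | cons a s =>
        rw [rowGT_cons] at h
        rw [rowInsert, if_pos h.1]
        exact rowGT_cons.2 ⟨hx, h.2⟩
    · have hby : b < y := (not_lt.1 hx).trans_lt hxy
      cases s with
      | nil => exact rowGT_cons.2 ⟨hby, rowGT_nil _⟩
      | cons a s =>
        rw [rowGT_cons] at h
        rw [rowInsert]
        split_ifs with hya
        · exact rowGT_cons.2 ⟨hby, rowGT_rowInsert_lower h.2⟩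
        · exact rowGT_cons.2 ⟨h.1, ih h.2 hy⟩

theorem isTableau_nil : IsTableau ([] : List (List A)) :=
  ⟨by simp, by simp, List.IsChain.nil⟩

theorem isTableau_cons {r : List A} {L : List (List A)} :
    IsTableau (r :: L) ↔
      r ≠ [] ∧ r.Pairwise (· ≤ ·) ∧ (∀ s ∈ L.head?, RowGT s r) ∧ IsTableau L := by
  constructor
  · rintro ⟨h1, h2, h3⟩
    rw [List.isChain_cons] at h3
    exact ⟨h1 r (by simp), h2 r (by simp), h3.1, fun s hs => h1 s (by simp [hs]),
      fun s hs => h2 s (by simp [hs]), h3.2⟩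
  · rintro ⟨h1, h2, h3, h4⟩
    refine ⟨?_, ?_, List.isChain_cons.2 ⟨h3, h4.chain⟩⟩
    · rintro s hs
      rcases List.mem_cons.1 hs with rfl | hs
      · exact h1
      · exact h4.ne_nil s hs
    · rintro s hs
      rcases List.mem_cons.1 hs with rfl | hs
      · exact h2
      · exact h4.mono s hs

theorem head?_insertRows (x : A) (L : List (List A)) :
    (insertRows x L).head? = some (rowInsert x (L.head?.getD [])).1 := by
  cases L with
  | nil => simp [insertRows, rowInsert]
  | cons r L =>
    rw [insertRows]
    split <;> simp_all

theorem isTableau_insertRows (x : A) {L : List (List A)} (h : IsTableau L) :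
    IsTableau (insertRows x L) := by
  induction L generalizing x with
  | nil => exact isTableau_cons.2 ⟨by simp, by simp, by simp, isTableau_nil⟩
  | cons r L ih =>
    obtain ⟨h1, h2, h3, h4⟩ := isTableau_cons.1 h
    have e1 := rowInsert_ne_nil x r
    have e2 := rowInsert_mono (x := x) h2
    rw [insertRows]
    split
    · rename_i r' he
      rw [he] at e1 e2
      refine isTableau_cons.2 ⟨e1, e2, fun s hs => ?_, h4⟩
      have := rowGT_rowInsert_lower (x := x) (h3 s hs)
      rwa [he] at this
    · rename_i r' y he
      rw [he] at e1 e2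
      refine isTableau_cons.2 ⟨e1, e2, fun s hs => ?_, ih y h4⟩
      rw [head?_insertRows] at hs
      have hs' := Option.some.inj hs
      subst hs'
      have h5 : RowGT (L.head?.getD []) r := by
        cases L with
        | nil => exact rowGT_nil _
        | cons s L => exact h3 s rfl
      have := rowGT_rowInsert (x := x) (y := y) h5 (by rw [he])
      rwa [he] at this

namespace YoungTableau

/-- The empty tableau. -/
def empty : YoungTableau A := ⟨[], isTableau_nil⟩

/-- Right Schensted insertion of a letter into a tableau. -/
def insertLetter (T : YoungTableau A) (x : A) : YoungTableau A :=
  ⟨insertRows x T.rows, isTableau_insertRows x T.isTableau⟩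

/-- The insertion map: the letters of the word are inserted one after the other. -/
def insertWord (T : YoungTableau A) (w : List A) : YoungTableau A :=
  w.foldl insertLetter T

/-- The row reading of a tableau: the rows from top to bottom, each from left to right. -/
def rowReading (T : YoungTableau A) : List A := T.rows.reverse.flatten

/-- The product of tableaux. -/
def ast (T T' : YoungTableau A) : YoungTableau A := T.insertWord T'.rowReading

/-- The row with number `i` of a tableau, counted from the bottom row `i = 0` up; it is the empty
row if the tableau has at most `i` rows. -/
def row (T : YoungTableau A) (i : ℕ) : Row A :=
  ⟨T.rows[i]?.getD [], by
    rcases h : T.rows[i]? with _ | r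
    · simp
    · exact T.isTableau.mono r (List.mem_of_getElem? h)⟩

theorem rowGT_trans {x y z : List A} (h : RowGT x y) (h' : RowGT y z) : RowGT x z :=
  ⟨h.1.trans h'.1, fun i hx hz =>
    (h'.2 i (hx.trans_le h.1) hz).trans (h.2 i hx (hx.trans_le h.1))⟩

theorem pairwise_rows (T : YoungTableau A) :
    T.rows.Pairwise fun lower upper => RowGT upper lower := by
  have : IsTrans (List A) fun lower upper => RowGT upper lower :=
    ⟨fun _ _ _ h h' => rowGT_trans h' h⟩
  exact List.isChain_iff_pairwise.1 T.isTableau.chain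

/-- The column with number `j` of a tableau, counted from the leftmost column `j = 0` to the right
and read from top to bottom; it is the empty column if the tableau has at most `j` columns. -/
def col (T : YoungTableau A) (j : ℕ) : Col A :=
  ⟨(T.rows.filterMap fun r => r[j]?).reverse, by
    rw [List.pairwise_reverse, List.pairwise_filterMap]
    refine T.pairwise_rows.imp fun {r s} hrs a ha b hb => ?_
    obtain ⟨hj, rfl⟩ := List.getElem?_eq_some_iff.1 ha
    obtain ⟨hj', rfl⟩ := List.getElem?_eq_some_iff.1 hb
    exact hrs.2 j hj' hj⟩

end YoungTableau

/-- A row, seen as a tableau with at most one row. -/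
def Row.toTableau (r : Row A) : YoungTableau A :=
  ⟨if r.word = [] then [] else [r.word], by
    split_ifs with h
    · exact isTableau_nil
    · exact isTableau_cons.2 ⟨h, r.mono, by simp, isTableau_nil⟩⟩

/-- A column, seen as a tableau with at most one column. -/
def Col.toTableau (c : Col A) : YoungTableau A :=
  ⟨c.word.reverse.map fun a => [a], by
    refine ⟨by simp, by simp, List.Pairwise.isChain ?_⟩
    rw [List.pairwise_map, List.pairwise_reverse]
    exact c.anti.imp fun h => rowGT_cons.2 ⟨h, rowGT_nil _⟩⟩

/-- The row braiding: `(r₁, r₂)` is sent to the upper and the lower row of the tableau `r₁ ∗ r₂`,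
which has at most two rows; if there is no upper (or no lower) row, the empty row is taken. -/
def sigmaR (p : Row A × Row A) : Row A × Row A :=
  ((p.1.toTableau.ast p.2.toTableau).row 1, (p.1.toTableau.ast p.2.toTableau).row 0)

/-- The column braiding: `(c₁, c₂)` is sent to the left and the right column of the tableau
`c₁ ∗ c₂`, which has at most two columns; if there is no right (or no left) column, the empty
column is taken. -/
def sigmaC (p : Col A × Col A) : Col A × Col A :=
  ((p.1.toTableau.ast p.2.toTableau).col 0, (p.1.toTableau.ast p.2.toTableau).col 1)

end Tableaux

end PlacticBraid

/-!
Insertion of a sorted word into a sorted list, with the bumped letters collected in a word, gives a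
map on pairs of sorted words: `(r, s)` goes to (letters of `r` bumped by `s`, resulting list). For
rows this is `sigmaR`. Column insertion obeys the same rules with `≤` in place of `<` as the
condition for bumping, words read backwards and pairs mirrored. So everything is proved once, for
a transitive and cotransitive relation `p` (`IsBumpRel`); `<` and `≤` are the two instances.

*Braiding.* A pair is fixed by the generic braiding `sigmaGen` iff its lower entry lies pointwise
below the upper one (`Dom`). Both sides of the Yang-Baxter equation are Knuth equivalent to the
given triple (`sigmaGen_knuthEquiv`), so it suffices that both are normal and that a Knuth class
contains at most one normal triple. Uniqueness (`eq_of_knuthEquiv_of_dom`) is Knuth's theorem: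
insertion into one list turns Knuth equivalent words into the same list and Knuth equivalent words
of bumped letters (`KnuthEquiv.bumpWord`), and a normal triple is recovered by insertion into three
empty lists. Normality of one side says that insertion preserves tableaux (`dom_of_normal_left`);
normality of the other side is the optimality of the greedy choice made by bumping
(`dom_bumpWord_of_sublist`, `dom_of_normal_right`).

*Columns.* `sigmaC` is defined by row insertion. For a normal pair of columns, row insertion of one
into the other just puts them side by side (`insertRowsWord_twoCols`), and by Knuth's theorem the
tableau `c₁ ∗ c₂` depends on the Knuth class of `c₁ c₂` only; this identifies `sigmaC` with the
mirror image of `sigmaGen (≤)` (`sigmaC_colEquiv`).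

*Monoids.* In the reduced structure monoid a sorted word is the product of its letters, because
appending a letter at the end bumps nothing; the two Knuth relations are then the values of the
braiding on a pair of a two-letter word and a letter (`map_sortedWord_eq_prod`,
`map_prod_eq_of_knuthEquiv`). So the universal properties give mutually inverse homomorphisms
(`exists_mulEquiv_plactic`).
-/

namespace PlacticBraid

/-! ### Bumping along a cotransitive relation -/

/-- A transitive and cotransitive relation, to be read as "`a` may bump `b`". On a linear order both
`<` (insertion into rows) and `≤` (insertion into columns) are of this kind; neither reflexivity nor
irreflexivity is required, so that one development serves both. -/
class IsBumpRel {A : Type*} (p : A → A → Prop) : Prop where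
  trans : ∀ {a b c}, p a b → p b c → p a c
  cotrans : ∀ {a c} (b), p a c → p a b ∨ p b c

instance isBumpRel_lt {A : Type*} [LinearOrder A] : IsBumpRel (fun a b : A => a < b) :=
  ⟨lt_trans, fun {a _} b h => (lt_or_ge a b).imp id fun h' => h'.trans_lt h⟩

instance isBumpRel_le {A : Type*} [LinearOrder A] : IsBumpRel (fun a b : A => a ≤ b) :=
  ⟨le_trans, fun {a _} b h => (le_total a b).imp id fun h' => h'.trans h⟩

section Relations

variable {A : Type*} {p : A → A → Prop}

section BumpRel

variable [IsBumpRel p]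

theorem rel_of_not_of_rel {x y z : A} (h : ¬ p y x) (h' : p y z) : p x z :=
  (IsBumpRel.cotrans x h').resolve_left h

theorem rel_of_rel_of_not {x y z : A} (h : p x y) (h' : ¬ p z y) : p x z :=
  (IsBumpRel.cotrans z h).resolve_right h'

theorem not_rel_of_not_of_rel {x y z : A} (h : ¬ p y x) (h' : p y z) : ¬ p z x :=
  fun h'' => h (IsBumpRel.trans h' h'')

theorem not_rel_of_rel_of_not {x y z : A} (h : p x y) (h' : ¬ p z y) : ¬ p z x :=
  fun h'' => h' (IsBumpRel.trans h'' h)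

theorem not_rel_trans {x y z : A} (h : ¬ p y x) (h' : ¬ p z y) : ¬ p z x :=
  fun h'' => (IsBumpRel.cotrans y h'').elim h' h

end BumpRel

/-- The congruence on words generated by the Knuth relations for `p`. For `p = (<)` these are the
Knuth relations; for `p = (≤)` they are the Knuth relations on reversed words. -/
inductive KnuthEquiv (p : A → A → Prop) : List A → List A → Prop
  | xzy {x y z : A} (hxy : ¬ p y x) (hyz : p y z) : KnuthEquiv p [x, z, y] [z, x, y]
  | yxz {x y z : A} (hxy : p x y) (hyz : ¬ p z y) : KnuthEquiv p [y, x, z] [y, z, x]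
  | refl (u : List A) : KnuthEquiv p u u
  | symm {u v : List A} : KnuthEquiv p u v → KnuthEquiv p v u
  | trans {u v w : List A} : KnuthEquiv p u v → KnuthEquiv p v w → KnuthEquiv p u w
  | append {u u' v v' : List A} :
      KnuthEquiv p u u' → KnuthEquiv p v v' → KnuthEquiv p (u ++ v) (u' ++ v')

theorem KnuthEquiv.append_left (w : List A) {u v : List A} (h : KnuthEquiv p u v) :
    KnuthEquiv p (w ++ u) (w ++ v) :=
  (KnuthEquiv.refl w).append h

theorem KnuthEquiv.append_right (w : List A) {u v : List A} (h : KnuthEquiv p u v) :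
    KnuthEquiv p (u ++ w) (v ++ w) :=
  h.append (KnuthEquiv.refl w)

end Relations

section Bump

variable {A : Type*} (p : A → A → Prop)

/-- Sortedness adapted to `p`: weakly increasing for `p = (<)`, strictly increasing for
`p = (≤)`. -/
abbrev Sorted (r : List A) : Prop := r.Pairwise fun a b => ¬ p b a

/-- `Dom R u v` says that `u` is at most as long as `v`, and that `R v_i u_i` for all positions `i`
of `u`. For `R = (<)` it is `RowGT u v`. -/
def Dom (R : A → A → Prop) : List A → List A → Prop
  | [], _ => True
  | _ :: _, [] => False
  | a :: s, b :: r => R b a ∧ Dom R s r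

variable [DecidableRel p]

/-- Insertion of `x` into `r`: the first letter `y` with `p x y` is replaced by `x` and returned; if
there is none, `x` is attached at the end. -/
def bump (x : A) : List A → List A × Option A
  | [] => ([x], none)
  | y :: r => if p x y then (x :: r, some y) else (y :: (bump x r).1, (bump x r).2)

/-- Insertion of the letters of a word, one after the other: the resulting list and the word of the
letters bumped on the way. -/
def bumpWord : List A → List A → List A × List A
  | r, [] => (r, [])
  | r, x :: w => ((bumpWord (bump p x r).1 w).1,
      (bump p x r).2.toList ++ (bumpWord (bump p x r).1 w).2)

end Bump

theorem Dom.comp {A : Type*} {R S Q : A → A → Prop} (hQ : ∀ a b c, R b a → S c b → Q c a)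
    {u v w : List A} (h : Dom R u v) (h' : Dom S v w) : Dom Q u w := by
  induction u generalizing v w with
  | nil => trivial
  | cons a u ih =>
    cases v with
    | nil => exact h.elim
    | cons b v =>
      cases w with
      | nil => exact h'.elim
      | cons c w => exact ⟨hQ _ _ _ h.1 h'.1, ih h.2 h'.2⟩

section Generic

variable {A : Type*} {p : A → A → Prop} [DecidableRel p]

@[simp] theorem bump_nil (x : A) : bump p x [] = ([x], none) := rfl

theorem bump_cons_pos {x b : A} (h : p x b) (r : List A) : bump p x (b :: r) = (x :: r, some b) := by
  simp [bump, h]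

theorem bump_cons_neg {x b : A} (h : ¬ p x b) (r : List A) :
    bump p x (b :: r) = (b :: (bump p x r).1, (bump p x r).2) := by
  simp [bump, h]

@[simp] theorem bumpWord_nil (r : List A) : bumpWord p r [] = (r, []) := rfl

theorem bumpWord_cons (r : List A) (x : A) (w : List A) :
    bumpWord p r (x :: w) = ((bumpWord p (bump p x r).1 w).1,
      (bump p x r).2.toList ++ (bumpWord p (bump p x r).1 w).2) := rfl

theorem bumpWord_append (r u v : List A) :
    bumpWord p r (u ++ v) = ((bumpWord p (bumpWord p r u).1 v).1,
      (bumpWord p r u).2 ++ (bumpWord p (bumpWord p r u).1 v).2) := by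
  induction u generalizing r with
  | nil => simp
  | cons x u ih => simp [bumpWord_cons, ih]

theorem bumpWord_cons_of_forall {b : A} {w : List A} (h : ∀ x ∈ w, ¬ p x b) (r : List A) :
    bumpWord p (b :: r) w = (b :: (bumpWord p r w).1, (bumpWord p r w).2) := by
  induction w generalizing r with
  | nil => rfl
  | cons x w ih =>
    simp only [List.mem_cons, forall_eq_or_imp] at h
    simp [bumpWord_cons, bump_cons_neg h.1, ih h.2]

theorem rel_of_mem_bump {x e : A} {r : List A} (h : (bump p x r).2 = some e) : p x e ∧ e ∈ r := by
  induction r with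
  | nil => simp at h
  | cons b r ih =>
    by_cases hx : p x b
    · simp only [bump_cons_pos hx, Option.some.injEq] at h
      simp [← h, hx]
    · rw [bump_cons_neg hx] at h
      exact ⟨(ih h).1, List.mem_cons_of_mem _ (ih h).2⟩

theorem mem_of_mem_bump {x z : A} {r : List A} (h : z ∈ (bump p x r).1) : z = x ∨ z ∈ r := by
  induction r with
  | nil => simpa using h
  | cons b r ih =>
    by_cases hx : p x b
    · rw [bump_cons_pos hx] at h
      simp only [List.mem_cons] at h ⊢
      tauto
    · rw [bump_cons_neg hx] at h
      simp only [List.mem_cons] at h ⊢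
      tauto

theorem bump_of_forall {x : A} {r : List A} (h : ∀ z ∈ r, ¬ p x z) :
    bump p x r = (r ++ [x], none) := by
  induction r with
  | nil => rfl
  | cons b r ih =>
    simp only [List.mem_cons, forall_eq_or_imp] at h
    simp [bump_cons_neg h.1, ih h.2]

theorem bumpWord_nil_left {w : List A} (h : Sorted p w) : bumpWord p [] w = (w, []) := by
  induction w with
  | nil => rfl
  | cons x w ih =>
    rw [Sorted, List.pairwise_cons] at h
    simp [bumpWord_cons, bumpWord_cons_of_forall h.1, ih h.2]

/-- A pair that is already stacked correctly is not changed: every letter of `v` bumps the letter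
of `u` above it. -/
theorem bumpWord_of_dom {u v : List A} (hv : Sorted p v) (h : Dom p u v) :
    bumpWord p u v = (v, u) := by
  induction u generalizing v with
  | nil => exact bumpWord_nil_left hv
  | cons a u ih =>
    cases v with
    | nil => exact h.elim
    | cons b v =>
      rw [Sorted, List.pairwise_cons] at hv
      simp [bumpWord_cons, bump_cons_pos h.1, bumpWord_cons_of_forall hv.1, ih hv.2 h.2]

variable (p) in
/-- Insertion of a word into a stack of `L.length` lists, where the letters bumped from one list are
inserted into the next one, and those bumped from the last list are dropped. -/
def stackInsert : List (List A) → List A → List (List A)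
  | [], _ => []
  | r :: L, w => (bumpWord p r w).1 :: stackInsert L (bumpWord p r w).2

theorem stackInsert_append (L : List (List A)) (u v : List A) :
    stackInsert p L (u ++ v) = stackInsert p (stackInsert p L u) v := by
  induction L generalizing u v with
  | nil => rfl
  | cons r L ih => simp [stackInsert, bumpWord_append, ih]

theorem stackInsert_of_dom {u v w : List A} (hu : Sorted p u) (hv : Sorted p v) (hw : Sorted p w)
    (huv : Dom p u v) (hvw : Dom p v w) :
    stackInsert p [[], [], []] (u ++ v ++ w) = [w, v, u] := by
  rw [stackInsert_append, stackInsert_append]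
  simp [stackInsert, bumpWord_nil_left hu, bumpWord_of_dom hv huv, bumpWord_of_dom hw hvw]

variable [IsBumpRel p]

theorem sorted_bump {x : A} {r : List A} (h : Sorted p r) : Sorted p (bump p x r).1 := by
  induction r with
  | nil => simp
  | cons b r ih =>
    rw [Sorted, List.pairwise_cons] at h
    by_cases hx : p x b
    · rw [bump_cons_pos hx]
      exact List.pairwise_cons.2 ⟨fun z hz => not_rel_of_rel_of_not hx (h.1 z hz), h.2⟩
    · rw [bump_cons_neg hx]
      refine List.pairwise_cons.2 ⟨fun z hz => ?_, ih h.2⟩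
      rcases mem_of_mem_bump hz with rfl | hz
      · exact hx
      · exact h.1 z hz

theorem sorted_bumpWord_fst {r w : List A} (h : Sorted p r) : Sorted p (bumpWord p r w).1 := by
  induction w generalizing r with
  | nil => exact h
  | cons x w ih => exact ih (sorted_bump h)

/-- Row bumping lemma: inserting a later letter bumps at a position further to the right. -/
theorem bump_bump_of_not_rel {y z d : A} {r : List A} (hr : Sorted p r) (h : ¬ p z y)
    (hd : (bump p z (bump p y r).1).2 = some d) :
    ∃ e, (bump p y r).2 = some e ∧ ¬ p d e := by
  induction r with
  | nil => simp [bump_cons_neg h] at hd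
  | cons b r ih =>
    rw [Sorted, List.pairwise_cons] at hr
    by_cases hy : p y b
    · rw [bump_cons_pos hy, bump_cons_neg h] at hd
      rw [bump_cons_pos hy]
      exact ⟨b, rfl, hr.1 d (rel_of_mem_bump hd).2⟩
    · rw [bump_cons_neg hy, bump_cons_neg (not_rel_trans hy h)] at hd
      rw [bump_cons_neg hy]
      exact ih hr.2 hd

/-- Row bumping lemma: inserting an earlier letter bumps at a position weakly to the left. -/
theorem bump_bump_of_rel {y z d : A} {r : List A} (hr : Sorted p r) (h : p y z)
    (hd : (bump p z r).2 = some d) :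
    ∃ e, (bump p y (bump p z r).1).2 = some e ∧ p e d := by
  induction r with
  | nil => simp at hd
  | cons b r ih =>
    rw [Sorted, List.pairwise_cons] at hr
    by_cases hz : p z b
    · rw [bump_cons_pos hz] at hd ⊢
      simp only [Option.some.injEq] at hd
      subst hd
      exact ⟨z, by rw [bump_cons_pos h], hz⟩
    · rw [bump_cons_neg hz] at hd ⊢
      by_cases hy : p y b
      · rw [bump_cons_pos hy]
        exact ⟨b, rfl, rel_of_not_of_rel hz (rel_of_mem_bump hd).1⟩
      · rw [bump_cons_neg hy]
        exact ih hr.2 hd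

/-- In the insertion of a sorted word, no letter is bumped after the first letter that has been
attached at the end. -/
theorem bumpWord_snd_eq_nil {x : A} {r w : List A} (hr : Sorted p r) (hw : Sorted p (x :: w))
    (h : (bump p x r).2 = none) : (bumpWord p (bump p x r).1 w).2 = [] := by
  induction w generalizing x r with
  | nil => rfl
  | cons y w ih =>
    rw [Sorted, List.pairwise_cons] at hw
    have hn : (bump p y (bump p x r).1).2 = none := by
      rw [Option.eq_none_iff_forall_ne_some]
      intro d hd
      obtain ⟨e, he, -⟩ := bump_bump_of_not_rel hr (hw.1 y (by simp)) hd
      simp [h] at he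
    simp [bumpWord_cons, hn, ih (sorted_bump hr) hw.2 hn]

/-- The letters bumped by a sorted word form a sorted word that dominates it. -/
theorem bumpWord_snd_dom {r w : List A} (hr : Sorted p r) (hw : Sorted p w) :
    Dom p (bumpWord p r w).2 w := by
  induction w generalizing r with
  | nil => trivial
  | cons x w ih =>
    rw [bumpWord_cons]
    rcases h : (bump p x r).2 with _ | e
    · simp [bumpWord_snd_eq_nil hr hw h, Dom]
    · exact ⟨(rel_of_mem_bump h).1, ih (sorted_bump hr) (List.pairwise_cons.1 hw).2⟩

theorem sorted_bumpWord_snd {r w : List A} (hr : Sorted p r) (hw : Sorted p w) :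
    Sorted p (bumpWord p r w).2 := by
  have key : ∀ {w r x d}, Sorted p r → Sorted p (x :: w) → (bump p x r).2 = some d →
      (∀ z ∈ (bumpWord p (bump p x r).1 w).2, ¬ p z d) ∧
        Sorted p (bumpWord p (bump p x r).1 w).2 := by
    intro w
    induction w with
    | nil => simp
    | cons y w ih =>
      intro r x d hr hw hd
      rw [bumpWord_cons]
      rw [Sorted, List.pairwise_cons] at hw
      rcases h : (bump p y (bump p x r).1).2 with _ | e
      · simp [bumpWord_snd_eq_nil (sorted_bump hr) hw.2 h]
      · obtain ⟨e', he', hle⟩ := bump_bump_of_not_rel hr (hw.1 y (by simp)) h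
        obtain rfl : d = e' := by simpa [hd] using he'
        obtain ⟨h1, h2⟩ := ih (sorted_bump hr) hw.2 h
        refine ⟨fun z hz => ?_, List.pairwise_cons.2 ⟨h1, h2⟩⟩
        rcases List.mem_cons.1 hz with rfl | hz
        · exact hle
        · exact not_rel_trans hle (h1 z hz)
  cases w with
  | nil => simp
  | cons x w =>
    rw [bumpWord_cons]
    rcases h : (bump p x r).2 with _ | e
    · simp [bumpWord_snd_eq_nil hr hw h]
    · exact List.pairwise_cons.2 (key hr hw h)

/-! ### Domination -/

theorem dom_bump_right {x : A} {s r : List A} (h : Dom p s r) : Dom p s (bump p x r).1 := by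
  induction s generalizing r with
  | nil => trivial
  | cons a s ih =>
    cases r with
    | nil => exact h.elim
    | cons b r =>
      by_cases hx : p x b
      · rw [bump_cons_pos hx]
        exact ⟨IsBumpRel.trans hx h.1, h.2⟩
      · rw [bump_cons_neg hx]
        exact ⟨h.1, ih h.2⟩

theorem dom_bump_bump {x y : A} {s r : List A} (h : Dom p s r) (hy : (bump p x r).2 = some y) :
    Dom p (bump p y s).1 (bump p x r).1 := by
  induction r generalizing s with
  | nil => simp at hy
  | cons b r ih =>
    by_cases hx : p x b
    · rw [bump_cons_pos hx] at hy ⊢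
      simp only [Option.some.injEq] at hy
      subst hy
      cases s with
      | nil => exact ⟨hx, trivial⟩
      | cons a s =>
        rw [bump_cons_pos h.1]
        exact ⟨hx, h.2⟩
    · rw [bump_cons_neg hx] at hy ⊢
      have hby : p b y := rel_of_not_of_rel hx (rel_of_mem_bump hy).1
      cases s with
      | nil => exact ⟨hby, trivial⟩
      | cons a s =>
        by_cases hya : p y a
        · rw [bump_cons_pos hya]
          exact ⟨hby, dom_bump_right h.2⟩
        · rw [bump_cons_neg hya]
          exact ⟨h.1, ih h.2 hy⟩

/-- Insertion of a word into the lower list of a stacked pair, and of the bumped letters into the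
upper one, gives a stacked pair. -/
theorem dom_bumpWord {s r : List A} (w : List A) (h : Dom p s r) :
    Dom p (bumpWord p s (bumpWord p r w).2).1 (bumpWord p r w).1 := by
  induction w generalizing s r with
  | nil => exact h
  | cons x w ih =>
    rw [bumpWord_cons]
    rcases hb : (bump p x r).2 with _ | y
    · exact ih (dom_bump_right h)
    · exact ih (dom_bump_bump h hb)

theorem dom_bumpWord_self {r w : List A} (hr : Sorted p r) (hw : Sorted p w) :
    Dom p (bumpWord p r w).2 (bumpWord p r w).1 := by
  have := dom_bumpWord (p := p) (s := []) (r := r) w trivial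
  rwa [bumpWord_nil_left (sorted_bumpWord_snd hr hw)] at this

theorem append_singleton_sublist_bump {x : A} {s r : List A} (hr : Sorted p r) (hs : s.Sublist r)
    (h : ∀ a ∈ s, ¬ p x a) : (s ++ [x]).Sublist (bump p x r).1 := by
  induction r generalizing s with
  | nil => simp [List.sublist_nil.1 hs]
  | cons d r ih =>
    rw [Sorted, List.pairwise_cons] at hr
    by_cases hx : p x d
    · have : s = [] := by
        refine List.eq_nil_iff_forall_not_mem.2 fun a ha => h a ha ?_
        rcases List.mem_cons.1 (hs.subset ha) with rfl | har
        · exact hx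
        · exact rel_of_rel_of_not hx (hr.1 a har)
      subst this
      simp [bump_cons_pos hx]
    · rw [bump_cons_neg hx]
      cases hs with
      | cons _ hs => exact (ih hr.2 hs h).cons d
      | cons_cons _ hs =>
        exact (ih hr.2 hs fun a ha => h a (List.mem_cons_of_mem _ ha)).cons_cons d

theorem sublist_bumpWord {r w : List A} (hr : Sorted p r) (hw : Sorted p w) :
    w.Sublist (bumpWord p r w).1 := by
  induction w using List.reverseRecOn with
  | nil => simp
  | append_singleton w x ih =>
    rw [Sorted, List.pairwise_append] at hw
    rw [bumpWord_append]
    exact append_singleton_sublist_bump (sorted_bumpWord_fst hr) (ih hw.1)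
      fun a ha => hw.2.2 a ha x (by simp)

theorem bump_of_cons_sublist {x c : A} {s r : List A} (hr : Sorted p r)
    (hs : (c :: s).Sublist r) (hx : p x c) :
    ∃ e, (bump p x r).2 = some e ∧ (∀ a, p c a → p e a) ∧ s.Sublist (bump p x r).1 := by
  induction r with
  | nil => simp at hs
  | cons d r ih =>
    rw [Sorted, List.pairwise_cons] at hr
    by_cases hd : p x d
    · rw [bump_cons_pos hd]
      refine ⟨d, rfl, fun a ha => ?_, ?_⟩
      · cases hs with
        | cons _ hs => exact rel_of_not_of_rel (hr.1 c (hs.subset (by simp))) ha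
        | cons_cons _ hs => exact ha
      · exact hs.tail.cons x
    · rw [bump_cons_neg hd]
      cases hs with
      | cons _ hs =>
        obtain ⟨e, h1, h2, h3⟩ := ih hr.2 hs
        exact ⟨e, h1, h2, h3.cons d⟩
      | cons_cons _ hs => exact absurd hx hd

/-- The greedy choice is optimal: if a sublist `s` of `r` dominates `w`, then the letters of `r`
bumped by `w` are at least as many as, and position by position not above, those of `s`. -/
theorem dom_bumpWord_of_sublist {r s w : List A} (hr : Sorted p r) (hs : s.Sublist r)
    (h : Dom p s w) : Dom (fun e c => ∀ a, p c a → p e a) s (bumpWord p r w).2 := by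
  induction w generalizing r s with
  | nil =>
    cases s with
    | nil => trivial
    | cons c s => exact h.elim
  | cons x w ih =>
    cases s with
    | nil => trivial
    | cons c s =>
      obtain ⟨e, h1, h2, h3⟩ := bump_of_cons_sublist hr hs h.1
      rw [bumpWord_cons, h1]
      exact ⟨h2, ih (sorted_bump hr) h3 h.2⟩

/-! ### Knuth equivalence -/

/-- The insertion of one letter is a consequence of the Knuth relations. -/
theorem knuthEquiv_bump {x : A} {r : List A} (hr : Sorted p r) :
    KnuthEquiv p (r ++ [x]) ((bump p x r).2.toList ++ (bump p x r).1) := by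
  induction r with
  | nil => exact KnuthEquiv.refl _
  | cons b r ih =>
    by_cases hx : p x b
    · rw [bump_cons_pos hx]
      clear ih
      -- `x` moves to the left through `r`: all letters that it passes, and `b`, can be bumped by it,
      -- so that the relation `yxz` applies at each step
      induction r using List.reverseRecOn with
      | nil => exact KnuthEquiv.refl _
      | append_singleton r z ih =>
        have hz : ¬ p z b := (List.pairwise_cons.1 hr).1 z (by simp)
        have ih' := (ih (hr.sublist (by simp))).append_right [z]
        refine KnuthEquiv.trans ?_ (by simpa using ih')
        rcases List.eq_nil_or_concat r with rfl | ⟨r, y, rfl⟩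
        · exact (KnuthEquiv.yxz hx hz).symm
        · have hy : ¬ p y b := (List.pairwise_cons.1 hr).1 y (by simp)
          have hzy : ¬ p z y := by
            have := (List.pairwise_cons.1 hr).2
            simp only [List.concat_eq_append] at this
            exact (List.pairwise_append.1 this).2.2 y (by simp) z (by simp)
          have := (KnuthEquiv.yxz (rel_of_rel_of_not hx hy) hzy).symm.append_left (b :: r)
          simpa using this
    · rw [bump_cons_neg hx]
      rw [Sorted, List.pairwise_cons] at hr
      refine KnuthEquiv.trans ((ih hr.2).append_left [b]) ?_
      rcases hd : (bump p x r).2 with _ | d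
      · exact KnuthEquiv.refl _
      · have hxd := (rel_of_mem_bump hd).1
        cases r with
        | nil => simp at hd
        | cons c r =>
          by_cases hc : p x c
          · rw [bump_cons_pos hc]
            exact (KnuthEquiv.xzy hx hxd).append_right r
          · rw [bump_cons_neg hc]
            exact (KnuthEquiv.xzy (hr.1 c (by simp)) (rel_of_not_of_rel hc hxd)).append_right _

theorem knuthEquiv_bumpWord {r : List A} (w : List A) (hr : Sorted p r) :
    KnuthEquiv p (r ++ w) ((bumpWord p r w).2 ++ (bumpWord p r w).1) := by
  induction w generalizing r with
  | nil => simpa using KnuthEquiv.refl r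
  | cons x w ih =>
    rw [bumpWord_cons]
    have h1 := (knuthEquiv_bump (x := x) hr).append_right w
    have h2 := (ih (sorted_bump (x := x) hr)).append_left (bump p x r).2.toList
    refine KnuthEquiv.trans (by simpa using h1) (by simpa using h2)

theorem bumpWord_xzy {x y z : A} {r : List A} (hr : Sorted p r) (hxy : ¬ p y x) (hyz : p y z) :
    (bumpWord p r [x, z, y]).1 = (bumpWord p r [z, x, y]).1 ∧
      KnuthEquiv p (bumpWord p r [x, z, y]).2 (bumpWord p r [z, x, y]).2 := by
  have hxz : p x z := rel_of_not_of_rel hxy hyz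
  have hzx : ¬ p z x := not_rel_of_not_of_rel hxy hyz
  induction r with
  | nil =>
    simp [bumpWord_cons, bump_cons_pos, bump_cons_neg, hxz, hzx, hxy, hyz, KnuthEquiv.refl]
  | cons b r ih =>
    rw [Sorted, List.pairwise_cons] at hr
    by_cases hxb : p x b
    · by_cases hzb : p z b
      · cases r with
        | nil =>
          simp [bumpWord_cons, bump_cons_pos, bump_cons_neg, hxz, hzx, hxy, hyz, hxb, hzb,
            KnuthEquiv.refl]
        | cons d r =>
          have hdb : ¬ p d b := hr.1 d (by simp)
          have hzd : p z d := rel_of_rel_of_not hzb hdb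
          have hyd : p y d := IsBumpRel.trans hyz hzd
          have := (KnuthEquiv.yxz hzb hdb).symm
          simpa [bumpWord_cons, bump_cons_pos, bump_cons_neg, hxz, hzx, hxy, hyz, hxb, hzb, hzd,
            hyd] using this
      · simp only [bumpWord_cons, bump_cons_pos, bump_cons_neg, hzx, hxy, hxb, hzb,
          bumpWord_nil, not_false_eq_true, true_and]
        rcases hd : (bump p z r).2 with _ | d
        · simpa using KnuthEquiv.refl _
        · obtain ⟨e, he, hed⟩ := bump_bump_of_rel hr.2 hyz hd
          have heb : ¬ p e b := by
            rcases mem_of_mem_bump (rel_of_mem_bump he).2 with rfl | h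
            · exact hzb
            · exact hr.1 e h
          simpa [he] using KnuthEquiv.xzy heb hed
    · have hyb : ¬ p y b := not_rel_trans hxb hxy
      have hzb : ¬ p z b := not_rel_trans hxb hzx
      rw [bumpWord_cons_of_forall (by simp [hxb, hyb, hzb]),
        bumpWord_cons_of_forall (by simp [hxb, hyb, hzb])]
      simpa using ih hr.2

theorem bumpWord_yxz {x y z : A} {r : List A} (hr : Sorted p r) (hxy : p x y) (hyz : ¬ p z y) :
    (bumpWord p r [y, x, z]).1 = (bumpWord p r [y, z, x]).1 ∧
      KnuthEquiv p (bumpWord p r [y, x, z]).2 (bumpWord p r [y, z, x]).2 := by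
  have hxz : p x z := rel_of_rel_of_not hxy hyz
  have hzx : ¬ p z x := not_rel_of_rel_of_not hxy hyz
  induction r with
  | nil =>
    simp [bumpWord_cons, bump_cons_pos, bump_cons_neg, hzx, hxy, hyz, KnuthEquiv.refl]
  | cons b r ih =>
    rw [Sorted, List.pairwise_cons] at hr
    by_cases hxb : p x b
    · by_cases hyb : p y b
      · simp only [bumpWord_cons, bump_cons_pos, bump_cons_neg, hzx, hxy, hyz, hyb,
          bumpWord_nil, not_false_eq_true, true_and]
        rcases hd : (bump p z r).2 with _ | d
        · simpa using KnuthEquiv.refl _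
        · simpa using KnuthEquiv.yxz hyb (hr.1 d (rel_of_mem_bump hd).2)
      · have hzb : ¬ p z b := not_rel_trans hyb hyz
        simp only [bumpWord_cons, bump_cons_pos, bump_cons_neg, hzx, hxb, hyb, hzb,
          bumpWord_nil, not_false_eq_true, true_and]
        rcases hd : (bump p z (bump p y r).1).2 with _ | d
        · simpa using KnuthEquiv.refl _
        · obtain ⟨e, he, hed⟩ := bump_bump_of_not_rel hr.2 hyz hd
          have hbe : p b e := rel_of_not_of_rel hyb (rel_of_mem_bump he).1
          simpa [he] using KnuthEquiv.yxz hbe hed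
    · have hyb : ¬ p y b := fun h => hxb (IsBumpRel.trans hxy h)
      have hzb : ¬ p z b := fun h => hxb (IsBumpRel.trans hxz h)
      rw [bumpWord_cons_of_forall (by simp [hxb, hyb, hzb]),
        bumpWord_cons_of_forall (by simp [hxb, hyb, hzb])]
      simpa using ih hr.2

/-- Insertion into one list respects Knuth equivalence: the resulting list is the same, and the
bumped words are again Knuth equivalent. -/
theorem KnuthEquiv.bumpWord {u v : List A} (h : KnuthEquiv p u v) {r : List A} (hr : Sorted p r) :
    (bumpWord p r u).1 = (bumpWord p r v).1 ∧
      KnuthEquiv p (bumpWord p r u).2 (bumpWord p r v).2 := by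
  induction h generalizing r with
  | xzy hxy hyz => exact bumpWord_xzy hr hxy hyz
  | yxz hxy hyz => exact bumpWord_yxz hr hxy hyz
  | refl u => exact ⟨rfl, .refl _⟩
  | symm _ ih => exact ⟨(ih hr).1.symm, (ih hr).2.symm⟩
  | trans _ _ ih ih' => exact ⟨(ih hr).1.trans (ih' hr).1, (ih hr).2.trans (ih' hr).2⟩
  | @append u₁ _ _ _ _ _ ih ih' =>
    have h1 := ih hr
    have h2 := ih' (sorted_bumpWord_fst (w := u₁) hr)
    rw [bumpWord_append, bumpWord_append, ← h1.1]
    exact ⟨h2.1, h1.2.append h2.2⟩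

theorem KnuthEquiv.stackInsert {u v : List A} (h : KnuthEquiv p u v) {L : List (List A)}
    (hL : ∀ r ∈ L, Sorted p r) : stackInsert p L u = stackInsert p L v := by
  induction L generalizing u v with
  | nil => rfl
  | cons r L ih =>
    obtain ⟨h1, h2⟩ := h.bumpWord (hL r (by simp))
    simp [PlacticBraid.stackInsert, h1, ih h2 fun s hs => hL s (by simp [hs])]

/-! ### The generic braiding -/

variable (p) in
/-- The words that are sorted for `p`. -/
abbrev SortedWord : Type _ := {r : List A // Sorted p r}

variable (p) in
/-- Insertion of the second sorted word into the first one, followed by the exchange of the places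
of the result and of the word of bumped letters. -/
def sigmaGen (t : SortedWord p × SortedWord p) : SortedWord p × SortedWord p :=
  (⟨(bumpWord p t.1.1 t.2.1).2, sorted_bumpWord_snd t.1.2 t.2.2⟩,
    ⟨(bumpWord p t.1.1 t.2.1).1, sorted_bumpWord_fst t.1.2⟩)

theorem sigmaGen_dom (t : SortedWord p × SortedWord p) :
    Dom p (sigmaGen p t).1.1 (sigmaGen p t).2.1 :=
  dom_bumpWord_self t.1.2 t.2.2

theorem sigmaGen_eq_self_iff {r s : SortedWord p} :
    sigmaGen p (r, s) = (r, s) ↔ Dom p r.1 s.1 := by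
  constructor
  · intro h
    have := sigmaGen_dom (r, s)
    rwa [h] at this
  · intro h
    simp [sigmaGen, bumpWord_of_dom s.2 h]

theorem sigmaGen_knuthEquiv (t : SortedWord p × SortedWord p) :
    KnuthEquiv p (t.1.1 ++ t.2.1) ((sigmaGen p t).1.1 ++ (sigmaGen p t).2.1) :=
  knuthEquiv_bumpWord _ t.1.2

theorem onLeft_knuthEquiv (t : SortedWord p × SortedWord p × SortedWord p) :
    KnuthEquiv p (t.1.1 ++ t.2.1.1 ++ t.2.2.1) ((onLeft (sigmaGen p) t).1.1 ++
      (onLeft (sigmaGen p) t).2.1.1 ++ (onLeft (sigmaGen p) t).2.2.1) :=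
  (sigmaGen_knuthEquiv (t.1, t.2.1)).append_right _

theorem onRight_knuthEquiv (t : SortedWord p × SortedWord p × SortedWord p) :
    KnuthEquiv p (t.1.1 ++ t.2.1.1 ++ t.2.2.1) ((onRight (sigmaGen p) t).1.1 ++
      (onRight (sigmaGen p) t).2.1.1 ++ (onRight (sigmaGen p) t).2.2.1) := by
  rw [List.append_assoc, List.append_assoc]
  exact (sigmaGen_knuthEquiv t.2).append_left _

/-- There is at most one normal triple in each class of Knuth equivalent triples. -/
theorem eq_of_knuthEquiv_of_dom {t t' : SortedWord p × SortedWord p × SortedWord p}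
    (h : KnuthEquiv p (t.1.1 ++ t.2.1.1 ++ t.2.2.1) (t'.1.1 ++ t'.2.1.1 ++ t'.2.2.1))
    (h1 : Dom p t.1.1 t.2.1.1) (h2 : Dom p t.2.1.1 t.2.2.1)
    (h1' : Dom p t'.1.1 t'.2.1.1) (h2' : Dom p t'.2.1.1 t'.2.2.1) : t = t' := by
  have e := h.stackInsert (L := [[], [], []]) (by simp)
  rw [stackInsert_of_dom t.1.2 t.2.1.2 t.2.2.2 h1 h2,
    stackInsert_of_dom t'.1.2 t'.2.1.2 t'.2.2.2 h1' h2'] at e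
  simp only [List.cons.injEq, and_true] at e
  exact Prod.ext (Subtype.ext e.2.2) (Prod.ext (Subtype.ext e.2.1) (Subtype.ext e.1))

/-- If `(r, s)` is normal, then two braidings bring `(r, s, w)` into normal form: this is the
insertion of `w` into a tableau with two rows. -/
theorem dom_of_normal_left {r s : SortedWord p} (w : SortedWord p) (h : Dom p r.1 s.1) :
    Dom p (sigmaGen p (r, (sigmaGen p (s, w)).1)).2.1 (sigmaGen p (s, w)).2.1 :=
  dom_bumpWord w.1 h

/-- If `(s, w)` is normal, then two braidings bring `(r, s, w)` into normal form. The letters of `r`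
bumped by `s` dominate `s`, which occurs inside the list into which `w` is inserted; as the greedy
choice is optimal, the letters bumped by `w` are not above those of `s`. -/
theorem dom_of_normal_right (r : SortedWord p) {s w : SortedWord p} (h : Dom p s.1 w.1) :
    Dom p (sigmaGen p (r, s)).1.1 (sigmaGen p ((sigmaGen p (r, s)).2, w)).1.1 :=
  Dom.comp (fun a _ _ hba hcb => hcb a hba) (bumpWord_snd_dom r.2 s.2)
    (dom_bumpWord_of_sublist (sorted_bumpWord_fst r.2) (sublist_bumpWord r.2 s.2) h)

variable (p) in
theorem sigmaGen_isBraiding : IsBraiding (sigmaGen p) := by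
  intro t
  refine eq_of_knuthEquiv_of_dom ?_ (sigmaGen_dom _) ?_ ?_ (sigmaGen_dom _)
  · exact (((onLeft_knuthEquiv t).trans (onRight_knuthEquiv _)).trans (onLeft_knuthEquiv _)).symm
      |>.trans (((onRight_knuthEquiv t).trans (onLeft_knuthEquiv _)).trans (onRight_knuthEquiv _))
  · exact dom_of_normal_left _ (sigmaGen_dom _)
  · exact dom_of_normal_right _ (sigmaGen_dom _)

variable (p) in
theorem sigmaGen_isPUIBS : IsPUIBS (sigmaGen p) ⟨[], List.Pairwise.nil⟩ where
  braiding := sigmaGen_isBraiding p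
  idem t := sigmaGen_eq_self_iff.2 (sigmaGen_dom t)
  left_unit x := Or.inl (sigmaGen_eq_self_iff.2 trivial)
  right_unit x := Or.inl rfl
  drop_unit u v h := by
    rw [IsNormal] at h ⊢
    rw [List.isChain_append] at h ⊢
    obtain ⟨h1, h2, h3⟩ := h
    rw [List.isChain_cons] at h2
    refine ⟨h1, h2.2, fun x hx y hy => ?_⟩
    -- a normal pair with empty second entry has empty first entry
    have hx' := sigmaGen_eq_self_iff.1 (h3 x hx _ rfl)
    rw [sigmaGen_eq_self_iff]
    rcases x with ⟨_ | ⟨a, x⟩, hs⟩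
    · trivial
    · exact hx'.elim

/-- A map to a monoid that is compatible with the generic braiding is multiplicative on the letters
of a sorted word. -/
theorem map_sortedWord_eq_prod {M : Type*} [Monoid M] (m : SortedWord p → M)
    (h1 : m ⟨[], List.Pairwise.nil⟩ = 1)
    (hm : ∀ t, m t.1 * m t.2 = m (sigmaGen p t).1 * m (sigmaGen p t).2) (r : SortedWord p) :
    m r = (r.1.map fun a => m ⟨[a], List.pairwise_singleton _ a⟩).prod := by
  obtain ⟨r, hr⟩ := r
  induction r using List.reverseRecOn with
  | nil => exact h1
  | append_singleton r x ih =>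
    have hr' := List.pairwise_append.1 hr
    have := hm (⟨r, hr'.1⟩, ⟨[x], List.pairwise_singleton _ x⟩)
    have hb : bump p x r = (r ++ [x], none) :=
      bump_of_forall fun z hz => hr'.2.2 z hz x (by simp)
    simp only [sigmaGen, bumpWord_cons, hb, bumpWord_nil, Option.toList_none, List.nil_append, h1,
      one_mul] at this
    rw [← this, ih]
    simp

/-- A map to a monoid that is compatible with the generic braiding satisfies the Knuth relations on
letters. -/
theorem map_prod_eq_of_knuthEquiv {M : Type*} [Monoid M] (m : SortedWord p → M)
    (h1 : m ⟨[], List.Pairwise.nil⟩ = 1)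
    (hm : ∀ t, m t.1 * m t.2 = m (sigmaGen p t).1 * m (sigmaGen p t).2) {u v : List A}
    (h : KnuthEquiv p u v) :
    (u.map fun a => m ⟨[a], List.pairwise_singleton _ a⟩).prod =
      (v.map fun a => m ⟨[a], List.pairwise_singleton _ a⟩).prod := by
  induction h with
  | @xzy x y z hxy hyz =>
    have hzx : ¬ p z x := not_rel_of_not_of_rel hxy hyz
    have := hm (⟨[x, z], by simpa using hzx⟩, ⟨[y], List.pairwise_singleton _ y⟩)
    have e : sigmaGen p (⟨[x, z], by simpa using hzx⟩, ⟨[y], List.pairwise_singleton _ y⟩) =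
        (⟨[z], List.pairwise_singleton _ z⟩, ⟨[x, y], by simpa using hxy⟩) := by
      simp [sigmaGen, bumpWord_cons, bump_cons_neg hxy, bump_cons_pos hyz]
    rw [e, map_sortedWord_eq_prod m h1 hm ⟨[x, z], _⟩, map_sortedWord_eq_prod m h1 hm ⟨[x, y], _⟩]
      at this
    simpa [mul_assoc] using this
  | @yxz x y z hxy hyz =>
    have := hm (⟨[y, z], by simpa using hyz⟩, ⟨[x], List.pairwise_singleton _ x⟩)
    have e : sigmaGen p (⟨[y, z], by simpa using hyz⟩, ⟨[x], List.pairwise_singleton _ x⟩) =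
        (⟨[y], List.pairwise_singleton _ y⟩,
          ⟨[x, z], by simpa using not_rel_of_rel_of_not hxy hyz⟩) := by
      simp [sigmaGen, bumpWord_cons, bump_cons_pos hxy]
    rw [e, map_sortedWord_eq_prod m h1 hm ⟨[y, z], _⟩, map_sortedWord_eq_prod m h1 hm ⟨[x, z], _⟩]
      at this
    simpa [mul_assoc] using this.symm
  | refl u => rfl
  | symm _ ih => exact ih.symm
  | trans _ _ ih ih' => exact ih.trans ih'
  | append _ _ ih ih' => simp [ih, ih']

end Generic

/-! ### Transport of braidings -/

section Transport

variable {X Y : Type*}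

theorem IsPUIBS.map {σ : X × X → X × X} {e : X} (h : IsPUIBS σ e) (φ : X ≃ Y)
    {τ : Y × Y → Y × Y} (hτ : ∀ x y, τ (φ x, φ y) = (φ (σ (x, y)).1, φ (σ (x, y)).2)) :
    IsPUIBS τ (φ e) := by
  have hfix : ∀ x y, τ (φ x, φ y) = (φ x, φ y) ↔ σ (x, y) = (x, y) := by
    intro x y
    rw [hτ, Prod.mk.injEq, Prod.ext_iff, φ.injective.eq_iff, φ.injective.eq_iff]
  have hnormal : ∀ w : List X, IsNormal τ (w.map φ) ↔ IsNormal σ w := by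
    intro w
    simp only [IsNormal, List.isChain_map, hfix]
  refine ⟨?_, ?_, ?_, ?_, ?_⟩
  · rintro ⟨y₁, y₂, y₃⟩
    obtain ⟨x₁, rfl⟩ := φ.surjective y₁
    obtain ⟨x₂, rfl⟩ := φ.surjective y₂
    obtain ⟨x₃, rfl⟩ := φ.surjective y₃
    have := h.braiding (x₁, x₂, x₃)
    simp only [onLeft, onRight, hτ] at this ⊢
    simpa only [Prod.mk.injEq, φ.injective.eq_iff, Prod.ext_iff] using this
  · rintro ⟨y₁, y₂⟩
    obtain ⟨x₁, rfl⟩ := φ.surjective y₁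
    obtain ⟨x₂, rfl⟩ := φ.surjective y₂
    rw [hτ, hfix]
    exact h.idem _
  · intro y
    obtain ⟨x, rfl⟩ := φ.surjective y
    rw [hτ]
    exact (h.left_unit x).imp (fun h => by rw [h]) (fun h => by rw [h])
  · intro y
    obtain ⟨x, rfl⟩ := φ.surjective y
    rw [hτ]
    exact (h.right_unit x).imp (fun h => by rw [h]) (fun h => by rw [h])
  · intro u v huv
    obtain ⟨u, rfl⟩ := φ.surjective.list_map u
    obtain ⟨v, rfl⟩ := φ.surjective.list_map v
    rw [← List.map_cons, ← List.map_append, hnormal] at huv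
    rw [← List.map_append, hnormal]
    exact h.drop_unit u v huv

/-- The mirror image of a pseudo-unital idempotent braided set is of the same kind: mirroring
exchanges the two sides of the Yang-Baxter equation and reverses normal words. -/
theorem IsPUIBS.mirror {σ : X × X → X × X} {e : X} (h : IsPUIBS σ e) :
    IsPUIBS (fun t => (σ t.swap).swap) e := by
  have hnormal : ∀ w : List X, IsNormal (fun t => (σ t.swap).swap) w ↔ IsNormal σ w.reverse := by
    intro w
    rw [IsNormal, IsNormal, List.isChain_reverse]
    simp only [Prod.swap_prod_mk, Prod.swap_eq_iff_eq_swap]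
  refine ⟨?_, ?_, ?_, ?_, ?_⟩
  · rintro ⟨x₁, x₂, x₃⟩
    have := h.braiding (x₃, x₂, x₁)
    simp only [onLeft, onRight, Prod.ext_iff, Prod.swap] at this ⊢
    exact ⟨this.2.2.symm, this.2.1.symm, this.1.symm⟩
  · intro t
    simp [h.idem]
  · intro x
    exact (h.right_unit x).symm.imp (fun h => by simp [h]) (fun h => by simp [h])
  · intro x
    exact (h.left_unit x).symm.imp (fun h => by simp [h]) (fun h => by simp [h])
  · intro u v huv
    rw [hnormal] at huv ⊢
    simp only [List.reverse_append, List.reverse_cons, List.append_assoc, List.cons_append,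
      List.nil_append] at huv ⊢
    exact h.drop_unit _ _ huv

end Transport

/-! ### The structure monoid and the plactic monoid -/

section Monoids

variable {A : Type*}

/-- Exchanging `p` for its complement with the arguments exchanged (in a linear order: `<` for `≤`)
amounts to reversing the words. -/
theorem KnuthEquiv.reverse {p q : A → A → Prop} (hpq : ∀ a b, p a b ↔ ¬ q b a) {u v : List A}
    (h : KnuthEquiv p u v) : KnuthEquiv q u.reverse v.reverse := by
  induction h with
  | xzy hxy hyz =>
    rw [hpq, not_not] at hxy
    exact (KnuthEquiv.yxz hxy ((hpq _ _).1 hyz)).symm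
  | yxz hxy hyz =>
    rw [hpq, not_not] at hyz
    exact (KnuthEquiv.xzy ((hpq _ _).1 hxy) hyz).symm
  | refl u => exact .refl _
  | symm _ ih => exact ih.symm
  | trans _ _ ih ih' => exact ih.trans ih'
  | append _ _ ih ih' =>
    rw [List.reverse_append, List.reverse_append]
    exact ih'.append ih

variable [LinearOrder A]

theorem ofWord_append (u v : List A) :
    Plactic.ofWord (u ++ v) = Plactic.ofWord u * Plactic.ofWord v := by
  rw [Plactic.ofWord, FreeMonoid.ofList_append, map_mul]
  rfl

theorem ofWord_eq_prod (u : List A) :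
    Plactic.ofWord u = (u.map fun a => PresentedMonoid.of (KnuthRel A) a).prod := by
  induction u with
  | nil => rfl
  | cons a u ih =>
    rw [List.map_cons, List.prod_cons, ← ih]
    exact ofWord_append [a] u

theorem KnuthEquiv.ofWord_eq {u v : List A} (h : KnuthEquiv (· < ·) u v) :
    Plactic.ofWord u = Plactic.ofWord v := by
  induction h with
  | xzy hxy hyz => exact PresentedMonoid.mk_eq_mk_of_rel (.xzy _ _ _ (not_lt.1 hxy) hyz)
  | yxz hxy hyz => exact PresentedMonoid.mk_eq_mk_of_rel (.yxz _ _ _ hxy (not_lt.1 hyz))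
  | refl u => rfl
  | symm _ ih => exact ih.symm
  | trans _ _ ih ih' => exact ih.trans ih'
  | append _ _ ih ih' => rw [ofWord_append, ofWord_append, ih, ih']

/-- If the letters of `X` are words in `A`, if the braiding respects Knuth equivalence, and if in
the reduced structure monoid all words are products of letters of `A`, and these satisfy the Knuth
relations, then the reduced structure monoid is the plactic monoid. -/
theorem exists_mulEquiv_plactic {X : Type*} (σ : X × X → X × X) (e : X) (word : X → List A)
    (ι : A → X)
    (hσ : ∀ t, KnuthEquiv (· < ·) (word t.1 ++ word t.2) (word (σ t).1 ++ word (σ t).2))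
    (he : word e = []) (hι : ∀ a, word (ι a) = [a])
    (hprod : ∀ x, PresentedMonoid.of (ReducedRel σ e) x =
      ((word x).map fun a => PresentedMonoid.of (ReducedRel σ e) (ι a)).prod)
    (hrel : ∀ u v, KnuthEquiv (· < ·) u v →
      (u.map fun a => PresentedMonoid.of (ReducedRel σ e) (ι a)).prod =
        (v.map fun a => PresentedMonoid.of (ReducedRel σ e) (ι a)).prod) :
    ∃ f : ReducedStructureMonoid σ e ≃* Plactic A,
      ∀ x, f (PresentedMonoid.of _ x) = Plactic.ofWord (word x) := by
  let f : ReducedStructureMonoid σ e →* Plactic A :=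
    PresentedMonoid.lift (fun x => Plactic.ofWord (word x)) (by
      rintro _ _ (⟨x, y, y', x', h⟩ | _)
      · have := (hσ (x, y)).ofWord_eq
        rw [h, ofWord_append, ofWord_append] at this
        simpa using this
      · rw [FreeMonoid.lift_eval_of, he, map_one]
        rfl)
  let g : Plactic A →* ReducedStructureMonoid σ e :=
    PresentedMonoid.lift (fun a => PresentedMonoid.of _ (ι a)) (by
      rintro _ _ (⟨x, y, z, hxy, hyz⟩ | ⟨x, y, z, hxy, hyz⟩)
      · rw [FreeMonoid.lift_apply, FreeMonoid.lift_apply]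
        exact hrel _ _ (.xzy (not_lt.2 hxy) hyz)
      · rw [FreeMonoid.lift_apply, FreeMonoid.lift_apply]
        exact hrel _ _ (.yxz hxy (not_lt.2 hyz)))
  have hf : ∀ x, f (PresentedMonoid.of _ x) = Plactic.ofWord (word x) := fun x =>
    PresentedMonoid.lift_of ..
  have hg : ∀ a, g (PresentedMonoid.of _ a) = PresentedMonoid.of _ (ι a) := fun a =>
    PresentedMonoid.lift_of ..
  refine ⟨MonoidHom.toMulEquiv f g ?_ ?_, hf⟩
  · refine PresentedMonoid.ext _ fun x => ?_
    rw [MonoidHom.comp_apply, hf, ofWord_eq_prod, map_list_prod, List.map_map, MonoidHom.id_apply,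
      hprod x]
    simp only [Function.comp_def, hg]
  · refine PresentedMonoid.ext _ fun a => ?_
    rw [MonoidHom.comp_apply, hg, hf, hι, ofWord_eq_prod]
    simp

theorem of_mul_of_eq {X : Type*} (σ : X × X → X × X) (e x y : X) :
    PresentedMonoid.of (ReducedRel σ e) x * PresentedMonoid.of (ReducedRel σ e) y =
      PresentedMonoid.of (ReducedRel σ e) (σ (x, y)).1 *
        PresentedMonoid.of (ReducedRel σ e) (σ (x, y)).2 :=
  PresentedMonoid.mk_eq_mk_of_rel (.braid _ _ _ _ rfl)

theorem of_unit_eq_one {X : Type*} (σ : X × X → X × X) (e : X) :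
    PresentedMonoid.of (ReducedRel σ e) e = 1 :=
  PresentedMonoid.mk_eq_mk_of_rel .unit

end Monoids

/-! ### Schensted insertion into tableaux -/

section Insertion

variable {A : Type*} [LinearOrder A]

theorem rowInsert_eq_bump (x : A) (r : List A) : rowInsert x r = bump (· < ·) x r := by
  induction r with
  | nil => rfl
  | cons b r ih => rw [rowInsert, bump, ih]

/-- Schensted insertion of the letters of a word into a list of rows. -/
def insertRowsWord (L : List (List A)) (w : List A) : List (List A) :=
  w.foldl (fun L x => insertRows x L) L

theorem insertRowsWord_cons (L : List (List A)) (x : A) (w : List A) :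
    insertRowsWord L (x :: w) = insertRowsWord (insertRows x L) w := rfl

theorem insertRowsWord_append (L : List (List A)) (u v : List A) :
    insertRowsWord L (u ++ v) = insertRowsWord (insertRowsWord L u) v :=
  List.foldl_append

theorem rows_insertWord (T : YoungTableau A) (w : List A) :
    (T.insertWord w).rows = insertRowsWord T.rows w := by
  induction w generalizing T with
  | nil => rfl
  | cons x w ih => exact ih _

theorem headD_insertRows (x : A) (L : List (List A)) :
    (insertRows x L).headD [] = (bump (· < ·) x (L.headD [])).1 := by
  rw [← rowInsert_eq_bump, List.headD_eq_head?_getD, head?_insertRows, List.headD_eq_head?_getD]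
  rfl

theorem tail_insertRows (x : A) (L : List (List A)) :
    (insertRows x L).tail = insertRowsWord L.tail (bump (· < ·) x (L.headD [])).2.toList := by
  cases L with
  | nil => rfl
  | cons r L =>
    rw [insertRows, List.headD_cons, ← rowInsert_eq_bump]
    split <;> simp_all [insertRowsWord]

theorem headD_insertRowsWord (L : List (List A)) (w : List A) :
    (insertRowsWord L w).headD [] = (bumpWord (· < ·) (L.headD []) w).1 := by
  induction w generalizing L with
  | nil => rfl
  | cons x w ih =>
    rw [insertRowsWord_cons, ih, headD_insertRows, bumpWord_cons]

theorem tail_insertRowsWord (L : List (List A)) (w : List A) :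
    (insertRowsWord L w).tail =
      insertRowsWord L.tail (bumpWord (· < ·) (L.headD []) w).2 := by
  induction w generalizing L with
  | nil => rfl
  | cons x w ih =>
    rw [insertRowsWord_cons, ih, headD_insertRows, tail_insertRows, bumpWord_cons,
      insertRowsWord_append]

theorem isTableau_insertRowsWord {L : List (List A)} (h : IsTableau L) (w : List A) :
    IsTableau (insertRowsWord L w) := by
  induction w generalizing L with
  | nil => exact h
  | cons x w ih => exact ih (isTableau_insertRows x h)

theorem sorted_headD {L : List (List A)} (hL : ∀ r ∈ L, r.Pairwise (· ≤ ·)) :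
    Sorted (· < ·) (L.headD []) := by
  cases L with
  | nil => simp
  | cons r L => exact (hL r (by simp)).imp not_lt.2

theorem getD_insertRowsWord_eq {u v : List A} (h : KnuthEquiv (· < ·) u v) {L : List (List A)}
    (hL : ∀ r ∈ L, r.Pairwise (· ≤ ·)) (k : ℕ) :
    (insertRowsWord L u)[k]?.getD [] = (insertRowsWord L v)[k]?.getD [] := by
  induction k generalizing L u v with
  | zero =>
    have h1 := (h.bumpWord (sorted_headD hL)).1
    rw [← List.head?_eq_getElem?, ← List.headD_eq_head?_getD, ← List.head?_eq_getElem?,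
      ← List.headD_eq_head?_getD, headD_insertRowsWord, headD_insertRowsWord, h1]
  | succ k ih =>
    rw [← List.getElem?_tail, ← List.getElem?_tail, tail_insertRowsWord, tail_insertRowsWord]
    exact ih (h.bumpWord (sorted_headD hL)).2 fun r hr => hL r (List.mem_of_mem_tail hr)

/-- Knuth's theorem: Knuth equivalent words are inserted into a tableau with the same result. -/
theorem KnuthEquiv.insertRowsWord_eq {u v : List A} (h : KnuthEquiv (· < ·) u v)
    {L : List (List A)} (hL : IsTableau L) : insertRowsWord L u = insertRowsWord L v := by
  refine List.ext_getElem? fun k => ?_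
  have hk := getD_insertRowsWord_eq h hL.mono k
  have hu := (isTableau_insertRowsWord hL u).ne_nil
  have hv := (isTableau_insertRowsWord hL v).ne_nil
  rcases h1 : (insertRowsWord L u)[k]? with _ | r <;>
    rcases h2 : (insertRowsWord L v)[k]? with _ | s
  · rfl
  · simp only [h1, h2, Option.getD_none, Option.getD_some] at hk
    exact absurd hk.symm (hv s (List.mem_of_getElem? h2))
  · simp only [h1, h2, Option.getD_none, Option.getD_some] at hk
    exact absurd hk (hu r (List.mem_of_getElem? h1))
  · simpa [h1, h2] using hk

end Insertion

/-! ### Rows -/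

section Rows

variable {A : Type*} [LinearOrder A]

variable (A) in
/-- Rows are the words that are sorted for `<`. -/
def rowEquiv : SortedWord (fun a b : A => a < b) ≃ Row A where
  toFun r := ⟨r.1, r.2.imp not_lt.1⟩
  invFun r := ⟨r.word, r.mono.imp not_lt.2⟩
  left_inv _ := rfl
  right_inv _ := rfl

theorem headD_rows_toTableau (r : Row A) : r.toTableau.rows.headD [] = r.word := by
  rw [Row.toTableau]
  split_ifs with h <;> simp [h]

theorem tail_rows_toTableau (r : Row A) : r.toTableau.rows.tail = [] := by
  rw [Row.toTableau]
  split_ifs with h <;> simp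

theorem rowReading_toTableau_row (r : Row A) : r.toTableau.rowReading = r.word := by
  rw [YoungTableau.rowReading, Row.toTableau]
  split_ifs with h <;> simp [h]

theorem sigmaR_rowEquiv (r s : SortedWord (fun a b : A => a < b)) :
    sigmaR (rowEquiv A r, rowEquiv A s) =
      (rowEquiv A (sigmaGen _ (r, s)).1, rowEquiv A (sigmaGen _ (r, s)).2) := by
  have hrows : ((rowEquiv A r).toTableau.ast (rowEquiv A s).toTableau).rows =
      insertRowsWord (rowEquiv A r).toTableau.rows s.1 := by
    rw [YoungTableau.ast, rows_insertWord, rowReading_toTableau_row]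
    rfl
  refine Prod.ext (Row.ext ?_) (Row.ext ?_)
  · change List.getD _ 1 [] = (bumpWord _ r.1 s.1).2
    rw [hrows, List.getD_eq_getElem?_getD, ← List.getElem?_tail, ← List.head?_eq_getElem?,
      ← List.headD_eq_head?_getD, tail_insertRowsWord, headD_insertRowsWord, headD_rows_toTableau,
      tail_rows_toTableau]
    exact congrArg Prod.fst (bumpWord_nil_left (sorted_bumpWord_snd r.2 s.2))
  · change List.getD _ 0 [] = (bumpWord _ r.1 s.1).1
    rw [hrows, List.getD_eq_getElem?_getD, ← List.head?_eq_getElem?, ← List.headD_eq_head?_getD,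
      headD_insertRowsWord, headD_rows_toTableau]
    rfl

variable (A) in
theorem sigmaR_isPUIBS : IsPUIBS (sigmaR (A := A)) Row.empty :=
  (sigmaGen_isPUIBS _).map (rowEquiv A) sigmaR_rowEquiv

variable (A) in
theorem exists_mulEquiv_row :
    ∃ f : ReducedStructureMonoid (sigmaR (A := A)) Row.empty ≃* Plactic A,
      ∀ r : Row A, f (PresentedMonoid.of _ r) = Plactic.ofWord r.word := by
  have hm (t : SortedWord (fun a b : A => a < b) × SortedWord (fun a b : A => a < b)) :
      PresentedMonoid.of (ReducedRel sigmaR Row.empty) (rowEquiv A t.1) *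
        PresentedMonoid.of (ReducedRel sigmaR Row.empty) (rowEquiv A t.2) =
      PresentedMonoid.of (ReducedRel sigmaR Row.empty) (rowEquiv A (sigmaGen _ t).1) *
        PresentedMonoid.of (ReducedRel sigmaR Row.empty) (rowEquiv A (sigmaGen _ t).2) := by
    rw [of_mul_of_eq, sigmaR_rowEquiv]
  refine exists_mulEquiv_plactic sigmaR Row.empty Row.word
    (fun a => rowEquiv A ⟨[a], List.pairwise_singleton _ a⟩) ?_ rfl (fun _ => rfl)
    (fun r => ?_) fun u v h => ?_
  · rintro ⟨r, s⟩
    obtain ⟨r, rfl⟩ := (rowEquiv A).surjective r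
    obtain ⟨s, rfl⟩ := (rowEquiv A).surjective s
    rw [sigmaR_rowEquiv]
    exact sigmaGen_knuthEquiv (r, s)
  · exact map_sortedWord_eq_prod (fun r => PresentedMonoid.of _ (rowEquiv A r))
      (of_unit_eq_one _ _) hm ((rowEquiv A).symm r)
  · exact map_prod_eq_of_knuthEquiv (fun r => PresentedMonoid.of _ (rowEquiv A r))
      (of_unit_eq_one _ _) hm h

end Rows

/-! ### Columns -/

section Columns

variable {A : Type*}

/-- The rows, from the bottom row up, of the diagram with left column `a` and right column `b`, both
given from bottom to top. Entries of `b` above the top of `a` are dropped. -/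
def twoCols : List A → List A → List (List A)
  | [], _ => []
  | x :: a, [] => [x] :: twoCols a []
  | x :: a, y :: b => [x, y] :: twoCols a b

theorem filterMap_twoCols_zero (a b : List A) : (twoCols a b).filterMap (fun r => r[0]?) = a := by
  induction a generalizing b with
  | nil => rfl
  | cons x a ih => cases b <;> simp [twoCols, ih]

theorem filterMap_twoCols_one {R : A → A → Prop} {a b : List A} (h : Dom R b a) :
    (twoCols a b).filterMap (fun r => r[1]?) = b := by
  induction a generalizing b with
  | nil =>
    cases b with
    | nil => rfl
    | cons y b => exact h.elim
  | cons x a ih =>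
    cases b with
    | nil => simpa [twoCols] using ih (b := []) trivial
    | cons y b => simpa [twoCols] using ih h.2

theorem twoCols_nil (a : List A) : twoCols a [] = a.map fun x => [x] := by
  induction a with
  | nil => rfl
  | cons x a ih => rw [twoCols, ih, List.map_cons]

variable [LinearOrder A]

variable (A) in
/-- Columns, read from bottom to top, are the words that are sorted for `≤`. -/
def colEquiv : SortedWord (fun a b : A => a ≤ b) ≃ Col A where
  toFun c := ⟨c.1.reverse, List.pairwise_reverse.2 (c.2.imp not_le.1)⟩
  invFun c := ⟨c.word.reverse, List.pairwise_reverse.2 (c.anti.imp not_le.2)⟩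
  left_inv _ := Subtype.ext (List.reverse_reverse _)
  right_inv _ := Col.ext (List.reverse_reverse _)

theorem insertRows_twoCols_nil {x : A} {a : List A} (h : Sorted (· ≤ ·) (x :: a)) :
    insertRows x (twoCols a []) = twoCols (x :: a) [] := by
  induction a generalizing x with
  | nil => rfl
  | cons y a ih =>
    rw [Sorted, List.pairwise_cons] at h
    have hxy : x < y := not_le.1 (h.1 y (by simp))
    simp [twoCols, insertRows, rowInsert, hxy, ih h.2]

theorem insertRowsWord_nil_reverse {a : List A} (h : Sorted (· ≤ ·) a) :
    insertRowsWord [] a.reverse = twoCols a [] := by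
  induction a with
  | nil => rfl
  | cons x a ih =>
    rw [List.reverse_cons, insertRowsWord_append, ih (List.pairwise_cons.1 h).2]
    exact insertRows_twoCols_nil h

theorem insertRows_twoCols {x : A} {a b : List A} (h : Sorted (· ≤ ·) (x :: b))
    (hd : Dom (· ≤ ·) (x :: b) a) : insertRows x (twoCols a b) = twoCols a (x :: b) := by
  induction a generalizing x b with
  | nil => exact hd.elim
  | cons y a ih =>
    have hyx : ¬ x < y := not_lt.2 hd.1
    cases b with
    | nil => simp [twoCols, insertRows, rowInsert, hyx]
    | cons z b =>
      rw [Sorted, List.pairwise_cons] at h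
      have hxz : x < z := not_le.1 (h.1 z (by simp))
      simp [twoCols, insertRows, rowInsert, hyx, hxz, ih h.2 hd.2]

theorem dom_tail {x : A} {b : List A} (h : Sorted (· ≤ ·) (x :: b)) :
    Dom (· ≤ ·) b (x :: b) := by
  induction b generalizing x with
  | nil => trivial
  | cons y b ih =>
    rw [Sorted, List.pairwise_cons] at h
    exact ⟨(not_le.1 (h.1 y (by simp))).le, ih h.2⟩

theorem insertRowsWord_twoCols {a b : List A} (h : Sorted (· ≤ ·) b) (hd : Dom (· ≤ ·) b a) :
    insertRowsWord (twoCols a []) b.reverse = twoCols a b := by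
  induction b with
  | nil => rfl
  | cons x b ih =>
    rw [List.reverse_cons, insertRowsWord_append,
      ih (List.pairwise_cons.1 h).2 (Dom.comp (fun _ _ _ h h' => h'.trans h) (dom_tail h) hd)]
    exact insertRows_twoCols h hd

theorem rowReading_toTableau_col (c : Col A) : c.toTableau.rowReading = c.word := by
  simp [YoungTableau.rowReading, Col.toTableau, ← List.map_reverse, List.flatten_eq_flatMap,
    List.flatMap_map]

theorem rows_ast_col (c d : SortedWord (fun a b : A => a ≤ b)) :
    ((colEquiv A c).toTableau.ast (colEquiv A d).toTableau).rows =
      insertRowsWord [] (c.1.reverse ++ d.1.reverse) := by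
  rw [YoungTableau.ast, rows_insertWord, rowReading_toTableau_col, insertRowsWord_append]
  congr 1
  rw [insertRowsWord_nil_reverse c.2, twoCols_nil]
  simp [Col.toTableau, colEquiv]

theorem sigmaGen_le_knuthEquiv (c d : SortedWord (fun a b : A => a ≤ b)) :
    KnuthEquiv (· < ·) (c.1.reverse ++ d.1.reverse)
      ((sigmaGen _ (d, c)).2.1.reverse ++ (sigmaGen _ (d, c)).1.1.reverse) := by
  rw [← List.reverse_append, ← List.reverse_append]
  exact (sigmaGen_knuthEquiv (d, c)).reverse fun _ _ => not_lt.symm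

/-- The column braiding is the mirror image of the generic braiding for `≤`: Schensted insertion
of a column into a column has the same result as the insertion, along columns, of the left column
into the right one, from bottom to top. -/
theorem sigmaC_colEquiv (c d : SortedWord (fun a b : A => a ≤ b)) :
    sigmaC (colEquiv A c, colEquiv A d) =
      (colEquiv A (sigmaGen _ (d, c)).2, colEquiv A (sigmaGen _ (d, c)).1) := by
  have hdom := sigmaGen_dom (d, c)
  have hrows : ((colEquiv A c).toTableau.ast (colEquiv A d).toTableau).rows =
      twoCols (sigmaGen _ (d, c)).2.1 (sigmaGen _ (d, c)).1.1 := by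
    rw [rows_ast_col, (sigmaGen_le_knuthEquiv c d).insertRowsWord_eq isTableau_nil,
      insertRowsWord_append, insertRowsWord_nil_reverse (sigmaGen _ (d, c)).2.2]
    exact insertRowsWord_twoCols (sigmaGen _ (d, c)).1.2 hdom
  refine Prod.ext (Col.ext ?_) (Col.ext ?_)
  · change (List.filterMap _ _).reverse = List.reverse _
    rw [hrows, filterMap_twoCols_zero]
  · change (List.filterMap _ _).reverse = List.reverse _
    rw [hrows, filterMap_twoCols_one hdom]

variable (A) in
theorem sigmaC_isPUIBS : IsPUIBS (sigmaC (A := A)) Col.empty :=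
  (sigmaGen_isPUIBS _).mirror.map (colEquiv A) sigmaC_colEquiv

variable (A) in
theorem exists_mulEquiv_col :
    ∃ f : ReducedStructureMonoid (sigmaC (A := A)) Col.empty ≃* Plactic A,
      ∀ c : Col A, f (PresentedMonoid.of _ c) = Plactic.ofWord c.word := by
  -- the mirror image makes it necessary to pass to the opposite monoid
  let m (c : SortedWord (fun a b : A => a ≤ b)) :
      (ReducedStructureMonoid (sigmaC (A := A)) Col.empty)ᵐᵒᵖ :=
    MulOpposite.op (PresentedMonoid.of _ (colEquiv A c))
  have h1 : m ⟨[], List.Pairwise.nil⟩ = 1 := congrArg MulOpposite.op (of_unit_eq_one _ _)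
  have hm (t) : m t.1 * m t.2 = m (sigmaGen _ t).1 * m (sigmaGen _ t).2 := by
    rw [← MulOpposite.op_mul, ← MulOpposite.op_mul, of_mul_of_eq, sigmaC_colEquiv]
  have hprod (w : List A) : (w.map fun a =>
      PresentedMonoid.of _ (colEquiv A ⟨[a], List.pairwise_singleton _ a⟩)).prod =
      (w.reverse.map fun a => m ⟨[a], List.pairwise_singleton _ a⟩).prod.unop := by
    rw [MulOpposite.unop_list_prod, List.map_map, List.map_reverse, List.reverse_reverse]
    rfl
  refine exists_mulEquiv_plactic sigmaC Col.empty Col.word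
    (fun a => colEquiv A ⟨[a], List.pairwise_singleton _ a⟩) ?_ rfl (fun _ => rfl)
    (fun c => ?_) fun u v h => ?_
  · rintro ⟨c, d⟩
    obtain ⟨c, rfl⟩ := (colEquiv A).surjective c
    obtain ⟨d, rfl⟩ := (colEquiv A).surjective d
    rw [sigmaC_colEquiv]
    exact sigmaGen_le_knuthEquiv c d
  · rw [hprod, ← MulOpposite.op_inj, MulOpposite.op_unop]
    conv_lhs => rw [← (colEquiv A).apply_symm_apply c]
    exact map_sortedWord_eq_prod m h1 hm ((colEquiv A).symm c)
  · rw [hprod, hprod, map_prod_eq_of_knuthEquiv m h1 hm (h.reverse fun _ _ => not_le.symm)]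

end Columns

end PlacticBraid

theorem theoremT (A : Type*) [LinearOrder A] :
    (PlacticBraid.IsPUIBS (PlacticBraid.sigmaR (A := A)) PlacticBraid.Row.empty ∧
      ∃ f : PlacticBraid.ReducedStructureMonoid
          (PlacticBraid.sigmaR (A := A)) PlacticBraid.Row.empty ≃* PlacticBraid.Plactic A,
        ∀ r : PlacticBraid.Row A,
          f (PresentedMonoid.of _ r) = PlacticBraid.Plactic.ofWord r.word) ∧
    (PlacticBraid.IsPUIBS (PlacticBraid.sigmaC (A := A)) PlacticBraid.Col.empty ∧
      ∃ g : PlacticBraid.ReducedStructureMonoid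
          (PlacticBraid.sigmaC (A := A)) PlacticBraid.Col.empty ≃* PlacticBraid.Plactic A,
        ∀ c : PlacticBraid.Col A,
          g (PresentedMonoid.of _ c) = PlacticBraid.Plactic.ofWord c.word) :=
  ⟨⟨PlacticBraid.sigmaR_isPUIBS A, PlacticBraid.exists_mulEquiv_row A⟩,
    ⟨PlacticBraid.sigmaC_isPUIBS A, PlacticBraid.exists_mulEquiv_col A⟩⟩
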